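/- Let $U\subset\mathbb C$ be a domain conformally equivalent to the unit disk $\mathbb D$, let $U'=U_1\cup\dots\cup U_N$ be a finite union of pairwise disjoint domains $U_i$, each conformally equivalent to $\mathbb D$, such that $\overline{U'}$ is compact and contained in $U$, and let $f:U'\to U$ be a proper holomorphic map (a generalized polynomial-like map). Its degree is $d=\sum_{i=1}^N d_i$, where $d_i$ is the degree of the proper map $f|_{U_i}:U_i\to U$, i.e. the number of preimages in $U_i$, counted with multiplicity, of any point of $U$. Put $$K_f=\{z\in U' : f^n(z)\in U' \text{ for all } n\in\mathbb N\},\qquad J_f=\partial K_f .$$ For $z\in K_f$ let $\deg(f^n,z)$ be the local degree of $f^n$ at $z$, i.e. the order of vanishing of $f^n-f^n(z)$ at $z$, and let $\chi(z)=\sup_{n\in\mathbb N}\deg(f^n,z)$. Let $\Sigma_d=\{0,\dots,d-1\}^{\mathbb N}$ carry the product topology (with $\{0,\dots,d-1\}$ discrete), and let $\sigma:\Sigma_d\to\Sigma_d$, $\sigma((\epsilon_i)_i)=(\epsilon_{i+1})_i$, be the shift. Theorem. Suppose that $d>1$, that $K_f=J_f$, that this set is a Cantor set (homeomorphic to $\{0,1\}^{\mathbb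 N}$), and that it contains all critical points of $f$ in $U'$. Then there is a continuous surjective map $\pi:\Sigma_d\to J_f$ such that $\pi\circ\sigma=f\circ\pi$ and, for every $z\in J_f$, $\chi(z)$ is finite and $$\#\pi^{-1}(z)=\chi(z).$$ -/

import Mathlib

open Set

noncomputable section

namespace GenPolyLike

/-- `V` is an open subset of the plane that is biholomorphic to the open unit disk. -/
def IsConformalDisk (V : Set ℂ) : Prop :=
  IsOpen V ∧ ∃ φ ψ : ℂ → ℂ,
    DifferentiableOn ℂ φ (Metric.ball 0 1) ∧ DifferentiableOn ℂ ψ V ∧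
    MapsTo φ (Metric.ball 0 1) V ∧ MapsTo ψ V (Metric.ball 0 1) ∧
    LeftInvOn ψ φ (Metric.ball 0 1) ∧ RightInvOn ψ φ V

/-- `f : U' → U` is a generalized polynomial-like map, where `U'` is the disjoint union of the
disks `V i`. Only the values of `f` on `U'` matter. -/
structure IsGenPolyLikeMap {N : ℕ} (f : ℂ → ℂ) (U' U : Set ℂ) (V : Fin N → Set ℂ) : Prop where
  disk_codomain : IsConformalDisk U
  disk_piece : ∀ i, IsConformalDisk (V i)
  disjoint_pieces : ∀ i j, i ≠ j → Disjoint (V i) (V j)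
  domain_eq : U' = ⋃ i, V i
  compact_closure : IsCompact (closure U')
  closure_subset : closure U' ⊆ U
  holomorphic : DifferentiableOn ℂ f U'
  mapsTo : MapsTo f U' U
  proper : IsProperMap (mapsTo.restrict f U' U)

/-- The local degree `deg(f, z)`: the order of vanishing of `f - f z` at `z`. -/
def localDegree (f : ℂ → ℂ) (z : ℂ) : ℕ∞ :=
  analyticOrderAt (fun w => f w - f z) z

/-- The number of preimages of `w` in `V` under `f`, counted with multiplicity. -/
def fibreCount (f : ℂ → ℂ) (V : Set ℂ) (w : ℂ) : ℕ∞ :=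
  ∑' z : {z : ℂ // z ∈ V ∧ f z = w}, localDegree f z

/-- The degree of `f : V → W`: the number of preimages in `V`, counted with multiplicity, of the
points of `W`. (For a proper holomorphic map between disks this number is the same for all points
of `W`; the supremum names the common value.) -/
def mapDegree (f : ℂ → ℂ) (V W : Set ℂ) : ℕ∞ :=
  ⨆ w ∈ W, fibreCount f V w

/-- The filled-in Julia set: the points all of whose iterates are defined and stay in `U'`. -/
def filledJulia (f : ℂ → ℂ) (U' : Set ℂ) : Set ℂ :=
  {z | z ∈ U' ∧ ∀ n : ℕ, f^[n] z ∈ U'}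

/-- The Julia set: the topological boundary of the filled-in Julia set. -/
def julia (f : ℂ → ℂ) (U' : Set ℂ) : Set ℂ :=
  frontier (filledJulia f U')

/-- `S` is a Cantor set: it is homeomorphic to the Cantor space `{0,1}^ℕ`. -/
def IsCantorSet (S : Set ℂ) : Prop :=
  Nonempty (S ≃ₜ (ℕ → Bool))

/-- The total branching `χ(z) = sup_n deg(f^n, z)`. -/
def chi (f : ℂ → ℂ) (z : ℂ) : ℕ∞ :=
  ⨆ n : ℕ, localDegree (f^[n]) z

/-- The one-sided shift on `Σ_d = {0, …, d-1}^ℕ`. -/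
def shift {d : ℕ} (ε : ℕ → Fin d) : ℕ → Fin d :=
  fun i => ε (i + 1)

end GenPolyLike

end

noncomputable section

namespace GenPolyLike

open Filter Topology

/-! Call the components of `level n` (the domain of the `n`-th iterate) the pieces of level `n`.
They are nested, and `f` maps each piece of level `n + 1` into a piece of level `n`. Since $K_f$ is
a compact, totally disconnected intersection of the levels, pieces separate its points
(`exists_pieceIndex_ne`). Hence a point of $K_f$ is determined by the sequence of its pieces, and
numbering the pieces orders $K_f$ lexicographically, each piece being an order interval.

List the fibre over each `y` in increasing order, with multiplicity; the `a`-th entry defines a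
section `s · a`, for `d` letters `a`. A proper holomorphic map takes all values of a connected set
equally often in a union of pieces (`count_biUnion_pieces_eq`), so if `y` and `y'` share a piece of
level `n`, their `a`-th preimages share one of level `n + 1` (`exists_sections`). The sections thus
gain one level at each application, and composing them along `ε` converges to a point `π ε`
(`exists_semiconj`).

Moreover `π ε = z` exactly when, for every `k`, the letter `ε k` selects $f^k(z)$ in the fibre over
$f^{k+1}(z)$. The choices are independent, and there are $\deg(f, f^k(z))$ of them, so the fibre of
`π` has $\prod_k \deg(f, f^k(z)) = \chi(z)$ elements. The product is finite: $K_f$ contains finitely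
many critical points, and none is periodic, since a superattracting cycle would be interior to $K_f
= \partial K_f$. -/

/-! ### Local degree and the local behaviour of holomorphic maps -/

/-- The local degree as a natural number (zero if it is infinite). -/
def mult (f : ℂ → ℂ) (z : ℂ) : ℕ :=
  (localDegree f z).toNat

theorem localDegree_ne_zero {f : ℂ → ℂ} {z : ℂ} (hf : AnalyticAt ℂ f z) :
    localDegree f z ≠ 0 := by
  unfold localDegree
  rw [analyticOrderAt_ne_zero]
  exact ⟨hf.sub analyticAt_const, by simp⟩

theorem localDegree_eq_one {f : ℂ → ℂ} {z : ℂ} (hf : AnalyticAt ℂ f z) (h : deriv f z ≠ 0) :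
    localDegree f z = 1 :=
  hf.analyticOrderAt_sub_eq_one_of_deriv_ne_zero h

theorem mult_eq_one {f : ℂ → ℂ} {z : ℂ} (hf : AnalyticAt ℂ f z) (h : deriv f z ≠ 0) :
    mult f z = 1 := by
  simp [mult, localDegree_eq_one hf h]

/-- A nonvanishing analytic germ has an analytic `n`-th root. -/
theorem exists_analyticAt_pow_eq {h : ℂ → ℂ} {z₀ : ℂ} (hh : AnalyticAt ℂ h z₀) (h0 : h z₀ ≠ 0)
    {n : ℕ} (hn : n ≠ 0) :
    ∃ k : ℂ → ℂ, AnalyticAt ℂ k z₀ ∧ k z₀ ≠ 0 ∧ ∀ᶠ z in 𝓝 z₀, k z ^ n = h z := by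
  obtain ⟨r, hr⟩ := IsAlgClosed.exists_pow_nat_eq (h z₀) (Nat.pos_of_ne_zero hn)
  have hr0 : r ≠ 0 := by
    rintro rfl
    rw [zero_pow hn] at hr
    exact h0 hr.symm
  have hq : AnalyticAt ℂ (fun z => h z / h z₀) z₀ := hh.div analyticAt_const h0
  have hs : h z₀ / h z₀ ∈ Complex.slitPlane := by
    rw [div_self h0]
    exact Complex.one_mem_slitPlane
  -- Dividing by `h z₀` brings the values close to 1, where the principal logarithm is analytic.
  refine ⟨fun z => r * Complex.exp (Complex.log (h z / h z₀) / n), ?_, ?_, ?_⟩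
  · exact analyticAt_const.mul
      (((hq.clog hs).div analyticAt_const (Nat.cast_ne_zero.2 hn)).cexp)
  · exact mul_ne_zero hr0 (Complex.exp_ne_zero _)
  · filter_upwards [hh.continuousAt.eventually_ne h0] with z hz
    rw [mul_pow, hr, ← Complex.exp_nat_mul, mul_div_cancel₀ _ (Nat.cast_ne_zero.2 hn),
      Complex.exp_log (div_ne_zero hz h0), mul_div_cancel₀ _ h0]

/-- Local normal form of a holomorphic map at a point of finite local degree `n`. -/
theorem exists_normalForm {f : ℂ → ℂ} {z₀ : ℂ} (hf : AnalyticAt ℂ f z₀) {n : ℕ}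
    (hn : localDegree f z₀ = n) :
    ∃ g : ℂ → ℂ, AnalyticAt ℂ g z₀ ∧ g z₀ = 0 ∧ deriv g z₀ ≠ 0 ∧
      ∀ᶠ z in 𝓝 z₀, f z = f z₀ + g z ^ n := by
  have hn0 : n ≠ 0 := by
    rintro rfl
    exact localDegree_ne_zero hf (by simpa using hn)
  obtain ⟨h, hh, h0, hfh⟩ :=
    ((hf.sub analyticAt_const : AnalyticAt ℂ (fun w => f w - f z₀) z₀).analyticOrderAt_eq_natCast).1
      hn
  obtain ⟨k, hk, hk0, hkh⟩ := exists_analyticAt_pow_eq hh h0 hn0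
  have hd : HasDerivAt (fun z => (z - z₀) * k z) (1 * k z₀ + (z₀ - z₀) * deriv k z₀) z₀ :=
    ((hasDerivAt_id z₀).sub_const z₀).mul hk.differentiableAt.hasDerivAt
  refine ⟨fun z => (z - z₀) * k z, (analyticAt_id.sub analyticAt_const).mul hk, by simp, ?_, ?_⟩
  · rw [hd.deriv]
    simpa using hk0
  · filter_upwards [hfh, hkh] with z h1 h2
    rw [mul_pow, h2, ← smul_eq_mul, ← h1, Pi.sub_apply, add_sub_cancel]

/-- Near a point of local degree `n`, a holomorphic map takes each nearby value `n` times. -/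
theorem exists_local_count {f : ℂ → ℂ} {z₀ : ℂ} (hf : AnalyticAt ℂ f z₀) {n : ℕ}
    (hn : localDegree f z₀ = n) {O : Set ℂ} (hO : O ∈ 𝓝 z₀) :
    ∃ N ⊆ O, IsOpen N ∧ z₀ ∈ N ∧ ∀ᶠ w in 𝓝 (f z₀), ∃ S : Finset ℂ,
      (S : Set ℂ) = {z | z ∈ N ∧ f z = w} ∧ ∑ z ∈ S, mult f z = n := by
  have hn0 : n ≠ 0 := by
    rintro rfl
    exact localDegree_ne_zero hf (by simpa using hn)
  obtain ⟨g, hg, hg0, hg', hfg⟩ := exists_normalForm hf hn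
  have hgood : ∀ᶠ z in 𝓝 z₀, z ∈ O ∧ (f =ᶠ[𝓝 z] fun z => f z₀ + g z ^ n) ∧
      AnalyticAt ℂ f z ∧ AnalyticAt ℂ g z ∧ deriv g z ≠ 0 := by
    filter_upwards [hO, hfg.eventually_nhds, hf.eventually_analyticAt, hg.eventually_analyticAt,
      hg.deriv.continuousAt.eventually_ne hg'] with z h1 h2 h3 h4 h5
    exact ⟨h1, h2, h3, h4, h5⟩
  obtain ⟨G, hGgood, hGo, hzG⟩ := eventually_nhds_iff.1 hgood
  -- In the coordinate `g` the equation `f z = w` becomes `u ^ n = w - f z₀`, so preimages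
  -- correspond to `n`-th roots.
  have hstrict := hg.hasStrictDerivAt.hasStrictFDerivAt_equiv hg'
  set e := (hstrict.toOpenPartialHomeomorph g).restrOpen G hGo with he
  have hcoe : ∀ z, e z = g z := fun z => rfl
  have hsrc : e.source ⊆ G := by
    intro z hz
    exact hz.2
  have hz₀ : z₀ ∈ e.source := ⟨hstrict.mem_toOpenPartialHomeomorph_source, hzG⟩
  have h0t : (0 : ℂ) ∈ e.target := by
    rw [← hg0, ← hcoe]
    exact e.map_source hz₀
  obtain ⟨r, hr, hball⟩ := Metric.isOpen_iff.1 e.open_target 0 h0t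
  refine ⟨e.source ∩ e ⁻¹' Metric.ball 0 r, ?_, e.isOpen_inter_preimage Metric.isOpen_ball,
    ⟨hz₀, by simp [hcoe, hg0, hr]⟩, ?_⟩
  · intro z hz
    exact (hGgood z (hsrc hz.1)).1
  -- The radius `r ^ n` forces all `n`-th roots of `w - f z₀` into the ball of radius `r` on which
  -- `e.symm` is defined.
  have hW : Metric.ball (f z₀) (r ^ n) ∈ 𝓝 (f z₀) := Metric.ball_mem_nhds _ (pow_pos hr n)
  filter_upwards [hW] with w hw
  set t := w - f z₀ with ht
  have htr : ‖t‖ < r ^ n := by rwa [mem_ball_iff_norm] at hw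
  have hroot : ∀ u : ℂ, u ^ n = t → u ∈ Metric.ball (0 : ℂ) r := by
    intro u hu
    rw [mem_ball_zero_iff]
    rw [← hu, norm_pow] at htr
    exact lt_of_pow_lt_pow_left₀ n hr.le htr
  have hfe : ∀ z ∈ e.source, (f z = w ↔ e z ^ n = t) := by
    intro z hz
    rw [(hGgood z (hsrc hz)).2.1.self_of_nhds, hcoe, ht, eq_sub_iff_add_eq']
  classical
  have hmem : ∀ u, u ∈ (Polynomial.nthRoots n t).toFinset ↔ u ^ n = t := by
    intro u
    rw [Multiset.mem_toFinset, Polynomial.mem_nthRoots (Nat.pos_of_ne_zero hn0)]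
  have himg : (((Polynomial.nthRoots n t).toFinset.image e.symm : Finset ℂ) : Set ℂ) =
      {z | z ∈ e.source ∩ e ⁻¹' Metric.ball 0 r ∧ f z = w} := by
    ext z
    simp only [Finset.coe_image, mem_image, Finset.mem_coe, hmem, mem_ofPred_eq, mem_inter_iff,
      mem_preimage]
    constructor
    · rintro ⟨u, hu, rfl⟩
      have hut := hball (hroot u hu)
      have hs := e.map_target hut
      rw [hfe _ hs, e.right_inv hut]
      exact ⟨⟨hs, hroot u hu⟩, hu⟩
    · rintro ⟨⟨hz, -⟩, hzw⟩
      exact ⟨e z, (hfe z hz).1 hzw, e.left_inv hz⟩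
  refine ⟨_, himg, ?_⟩
  have hinj : Set.InjOn e.symm ((Polynomial.nthRoots n t).toFinset : Set ℂ) := by
    intro u hu v hv huv
    rw [Finset.mem_coe, hmem] at hu hv
    exact e.symm.injOn (hball (hroot u hu)) (hball (hroot v hv)) huv
  rw [Finset.sum_image hinj]
  -- Either one root carrying multiplicity `n`, or `n` distinct roots at which `f` is unramified.
  by_cases ht0 : t = 0
  · have : (Polynomial.nthRoots n t).toFinset = {0} := by
      ext u
      rw [hmem, ht0, Finset.mem_singleton, pow_eq_zero_iff hn0]
    rw [this, Finset.sum_singleton]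
    have : e.symm 0 = z₀ := by
      rw [← hg0, ← hcoe]
      exact e.left_inv hz₀
    rw [this, mult, hn]
    rfl
  · have hone : ∀ u ∈ (Polynomial.nthRoots n t).toFinset, mult f (e.symm u) = 1 := by
      intro u hu
      rw [hmem] at hu
      have hut := hball (hroot u hu)
      have hs := e.map_target hut
      obtain ⟨-, hfz, hfa, hga, hgd⟩ := hGgood _ (hsrc hs)
      refine mult_eq_one hfa ?_
      have hgu : g (e.symm u) = u := by
        rw [← hcoe]
        exact e.right_inv hut
      have hd : HasDerivAt (fun z => f z₀ + g z ^ n)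
          (n * g (e.symm u) ^ (n - 1) * deriv g (e.symm u)) (e.symm u) :=
        (hga.differentiableAt.hasDerivAt.pow n).const_add _
      rw [hfz.deriv_eq, hd.deriv, hgu]
      have hu0 : u ≠ 0 := by
        rintro rfl
        rw [zero_pow hn0] at hu
        exact ht0 hu.symm
      exact mul_ne_zero (mul_ne_zero (Nat.cast_ne_zero.2 hn0) (pow_ne_zero _ hu0)) hgd
    rw [Finset.sum_congr rfl hone, Finset.sum_const, smul_eq_mul, mul_one]
    have hζ := Complex.isPrimitiveRoot_exp n hn0
    rw [Multiset.toFinset_card_of_nodup (hζ.nthRoots_nodup ht0), hζ.card_nthRoots,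
      if_pos (IsAlgClosed.exists_pow_nat_eq t (Nat.pos_of_ne_zero hn0))]

/-! ### Counting preimages of proper maps -/

/-- A proper holomorphic map between open subsets of the plane, with finite fibres and finite
local degrees. -/
structure IsFiniteProper (f : ℂ → ℂ) (U' U : Set ℂ) : Prop where
  isOpen_domain : IsOpen U'
  isOpen_codomain : IsOpen U
  holomorphic : DifferentiableOn ℂ f U'
  mapsTo : MapsTo f U' U
  proper : IsProperMap (mapsTo.restrict f U' U)
  localDegree_ne_top : ∀ z ∈ U', localDegree f z ≠ ⊤
  finite_fibre : ∀ w ∈ U, {z | z ∈ U' ∧ f z = w}.Finite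

/-- The number of preimages of `w` in `A`, counted with multiplicity, as a natural number. -/
def count (f : ℂ → ℂ) (A : Set ℂ) (w : ℂ) : ℕ :=
  ∑ᶠ z ∈ {z | z ∈ A ∧ f z = w}, mult f z

theorem count_eq_sum {f : ℂ → ℂ} {A : Set ℂ} {w : ℂ} {S : Finset ℂ}
    (hS : (S : Set ℂ) = {z | z ∈ A ∧ f z = w}) : count f A w = ∑ z ∈ S, mult f z := by
  rw [count, ← hS, finsum_mem_coe_finset]

namespace IsFiniteProper

variable {f : ℂ → ℂ} {U' U : Set ℂ}

theorem analyticAt (h : IsFiniteProper f U' U) {z : ℂ} (hz : z ∈ U') : AnalyticAt ℂ f z :=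
  h.holomorphic.analyticAt (h.isOpen_domain.mem_nhds hz)

theorem coe_mult (h : IsFiniteProper f U' U) {z : ℂ} (hz : z ∈ U') :
    (mult f z : ℕ∞) = localDegree f z :=
  ENat.natCast_toNat (h.localDegree_ne_top z hz)

theorem mult_pos (h : IsFiniteProper f U' U) {z : ℂ} (hz : z ∈ U') : 0 < mult f z := by
  have := localDegree_ne_zero (h.analyticAt hz)
  rw [← h.coe_mult hz] at this
  exact Nat.pos_of_ne_zero (by exact_mod_cast this)

/-- Proper maps are closed: the image of the part of `U'` outside `O` is closed in `U` and misses
`y`. -/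
theorem eventually_fibre_subset (h : IsFiniteProper f U' U) {y : ℂ} (hy : y ∈ U) {O : Set ℂ}
    (hO : IsOpen O) (hyO : ∀ z ∈ U', f z = y → z ∈ O) :
    ∀ᶠ w in 𝓝 y, ∀ z ∈ U', f z = w → z ∈ O := by
  have hcl := h.proper.isClosedMap _ ((hO.preimage continuous_subtype_val).isClosed_compl :
    IsClosed ((Subtype.val ⁻¹' O : Set U')ᶜ))
  obtain ⟨C, hC, hCeq⟩ := isClosed_induced_iff.1 hcl
  have hyC : y ∉ C := by
    intro hyC
    have : (⟨y, hy⟩ : U) ∈ (Subtype.val ⁻¹' C : Set U) := hyC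
    rw [hCeq] at this
    obtain ⟨z, hz, hzy⟩ := this
    exact hz (hyO z z.2 (congrArg Subtype.val hzy))
  filter_upwards [hC.isOpen_compl.mem_nhds hyC] with w hw z hz hzw
  by_contra hzO
  apply hw
  have : (⟨f z, h.mapsTo hz⟩ : U) ∈ (Subtype.val ⁻¹' C : Set U) := by
    rw [hCeq]
    exact ⟨⟨z, hz⟩, hzO, rfl⟩
  rw [← hzw]
  exact this

/-- The number of preimages in `A` is locally constant, as long as no preimage lies on the
boundary of `A`. -/
theorem eventually_count_eq (h : IsFiniteProper f U' U) {y : ℂ} (hy : y ∈ U) {A : Set ℂ}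
    (hA : A ⊆ U') (hyA : ∀ z ∈ U', f z = y → A ∈ 𝓝 z ∨ Aᶜ ∈ 𝓝 z) :
    ∀ᶠ w in 𝓝 y, count f A w = count f A y := by
  classical
  have hfin := h.finite_fibre y hy
  obtain ⟨O, hO, hdisj⟩ := hfin.t2_separation
  -- Each fibre point gets its own neighbourhood, disjoint from the others and entirely inside or
  -- outside `A`; only those inside contribute to the count.
  have hex : ∀ z : ℂ, z ∈ U' ∧ f z = y → ∃ N ⊆ O z ∩ U', IsOpen N ∧ z ∈ N ∧
      (N ⊆ A ∨ N ⊆ Aᶜ) ∧ ∀ᶠ w in 𝓝 y, ∃ S : Finset ℂ,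
      (S : Set ℂ) = {x | x ∈ N ∧ f x = w} ∧ ∑ x ∈ S, mult f x = mult f z := by
    rintro z ⟨hz, rfl⟩
    have hOU : O z ∩ U' ∈ 𝓝 z :=
      inter_mem ((hO z).2.mem_nhds (hO z).1) (h.isOpen_domain.mem_nhds hz)
    rcases hyA z hz rfl with hzA | hzA
    · obtain ⟨N, hN, hNo, hzN, hNw⟩ :=
        exists_local_count (h.analyticAt hz) (h.coe_mult hz).symm (inter_mem hOU hzA)
      exact ⟨N, hN.trans inter_subset_left, hNo, hzN, Or.inl (hN.trans inter_subset_right), hNw⟩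
    · obtain ⟨N, hN, hNo, hzN, hNw⟩ :=
        exists_local_count (h.analyticAt hz) (h.coe_mult hz).symm (inter_mem hOU hzA)
      exact ⟨N, hN.trans inter_subset_left, hNo, hzN, Or.inr (hN.trans inter_subset_right), hNw⟩
  choose! N hNO hNo hzN hNA hNw using hex
  have h1 : ∀ᶠ w in 𝓝 y, ∀ z ∈ {z | z ∈ U' ∧ f z = y}, ∃ S : Finset ℂ,
      (S : Set ℂ) = {x | x ∈ N z ∧ f x = w} ∧ ∑ x ∈ S, mult f x = mult f z :=
    hfin.eventually_all.2 fun z hz => hNw z hz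
  have h2 := h.eventually_fibre_subset hy
    (isOpen_biUnion fun z hz => hNo z hz : IsOpen (⋃ z ∈ {z | z ∈ U' ∧ f z = y}, N z))
    (fun z hz hzy => mem_biUnion (show z ∈ {z | z ∈ U' ∧ f z = y} from ⟨hz, hzy⟩)
      (hzN z ⟨hz, hzy⟩))
  filter_upwards [h1, h2] with w hw1 hw2
  choose! S hS hSsum using hw1
  set T := hfin.toFinset.filter (· ∈ A) with hT
  have hTmem : ∀ z, z ∈ T ↔ (z ∈ U' ∧ f z = y) ∧ z ∈ A := by
    intro z
    rw [hT, Finset.mem_filter, Finite.mem_toFinset]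
    rfl
  have hSmem : ∀ z, z ∈ U' ∧ f z = y → ∀ x, x ∈ S z ↔ x ∈ N z ∧ f x = w := by
    intro z hz x
    rw [← Finset.mem_coe, hS z hz]
    rfl
  have hTy : (T : Set ℂ) = {z | z ∈ A ∧ f z = y} := by
    ext z
    rw [Finset.mem_coe, hTmem]
    exact ⟨fun hz => ⟨hz.2, hz.1.2⟩, fun hz => ⟨⟨hA hz.1, hz.2⟩, hz.1⟩⟩
  have hTw : (T.biUnion S : Set ℂ) = {z | z ∈ A ∧ f z = w} := by
    ext x
    rw [Finset.mem_coe, Finset.mem_biUnion]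
    constructor
    · rintro ⟨z, hz, hx⟩
      obtain ⟨hz, hzA⟩ := (hTmem z).1 hz
      obtain ⟨hxN, hxw⟩ := (hSmem z hz x).1 hx
      rcases hNA z hz with hN | hN
      · exact ⟨hN hxN, hxw⟩
      · exact absurd hzA (hN (hzN z hz))
    · rintro ⟨hxA, hxw⟩
      obtain ⟨z, hz, hxN⟩ := mem_iUnion₂.1 (hw2 x (hA hxA) hxw)
      refine ⟨z, (hTmem z).2 ⟨hz, ?_⟩, (hSmem z hz x).2 ⟨hxN, hxw⟩⟩
      rcases hNA z hz with hN | hN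
      · exact hN (hzN z hz)
      · exact absurd hxA (hN hxN)
  rw [count_eq_sum hTy, count_eq_sum hTw, Finset.sum_biUnion]
  · exact Finset.sum_congr rfl fun z hz => hSsum z ((hTmem z).1 hz).1
  · intro z hz z' hz' hne
    have hz := ((hTmem z).1 hz).1
    have hz' := ((hTmem z').1 hz').1
    refine Finset.disjoint_left.2 fun x hx hx' => ?_
    have hd : Disjoint (O z) (O z') := hdisj hz hz' hne
    exact disjoint_left.1 hd (hNO z hz ((hSmem z hz x).1 hx).1).1
      (hNO z' hz' ((hSmem z' hz' x).1 hx').1).1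

/-- The count is locally constant and integer valued, hence constant on `D`. The neighbourhood
condition says that no preimage of a point of `D` lies on the frontier of `A`. -/
theorem count_eq_of_isPreconnected (h : IsFiniteProper f U' U) {A D : Set ℂ} (hA : A ⊆ U')
    (hD : IsPreconnected D) (hDU : D ⊆ U)
    (hDA : ∀ z ∈ U', f z ∈ D → A ∈ 𝓝 z ∨ Aᶜ ∈ 𝓝 z) {y y' : ℂ} (hy : y ∈ D) (hy' : y' ∈ D) :
    count f A y = count f A y' := by
  refine hD.constant (f := count f A) ?_ hy hy'
  intro w hw
  refine ContinuousAt.continuousWithinAt ?_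
  have := h.eventually_count_eq (hDU hw) hA fun z hz hzw => hDA z hz (hzw ▸ hw)
  exact (continuousAt_const (y := count f A w)).congr (this.mono fun _ hx => hx.symm)

end IsFiniteProper

/-! ### The degree of a generalized polynomial-like map -/

theorem sum_le_enat_tsum {ι : Type*} (g : ι → ℕ∞) (s : Finset ι) :
    ∑ i ∈ s, g i ≤ ∑' i, g i :=
  Summable.sum_le_tsum s (fun _ _ => zero_le) ⟨_, hasSum_of_isLUB _ isLUB_iSup⟩

theorem localDegree_le_fibreCount (f : ℂ → ℂ) {V : Set ℂ} {z : ℂ} (hz : z ∈ V) :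
    localDegree f z ≤ fibreCount f V (f z) := by
  simpa [fibreCount] using sum_le_enat_tsum
    (fun x : {x : ℂ // x ∈ V ∧ f x = f z} => localDegree f x) {⟨z, hz, rfl⟩}

theorem finite_of_fibreCount_ne_top {f : ℂ → ℂ} {V : Set ℂ} {w : ℂ}
    (hV : ∀ z ∈ V, localDegree f z ≠ 0) (hw : fibreCount f V w ≠ ⊤) :
    {z | z ∈ V ∧ f z = w}.Finite := by
  by_contra hinf
  obtain ⟨n, hn⟩ := ENat.ne_top_iff_exists.1 hw
  have : Infinite {z : ℂ // z ∈ V ∧ f z = w} := infinite_coe_iff.2 hinf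
  obtain ⟨s, hs⟩ := Infinite.exists_subset_card_eq {z : ℂ // z ∈ V ∧ f z = w} (n + 1)
  have h1 : ((n + 1 : ℕ) : ℕ∞) ≤ fibreCount f V w := by
    refine le_trans ?_ (sum_le_enat_tsum (fun x : {z : ℂ // z ∈ V ∧ f z = w} => localDegree f x) s)
    calc ((n + 1 : ℕ) : ℕ∞) = ∑ x ∈ s, (1 : ℕ∞) := by simp [hs]
      _ ≤ _ := Finset.sum_le_sum fun x _ => Order.one_le_iff_pos.2 (pos_iff_ne_zero.2 (hV x x.2.1))
  rw [← hn] at h1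
  have h2 : n + 1 ≤ n := by exact_mod_cast h1
  omega

theorem IsConformalDisk.isConnected {V : Set ℂ} (hV : IsConformalDisk V) : IsConnected V := by
  obtain ⟨-, φ, ψ, hφ, -, hφV, hψV, -, hr⟩ := hV
  have : V = φ '' Metric.ball 0 1 := by
    ext z
    exact ⟨fun hz => ⟨ψ z, hψV hz, hr hz⟩, fun ⟨w, hw, hz⟩ => hz ▸ hφV hw⟩
  rw [this]
  exact ((convex_ball (0 : ℂ) 1).isConnected (Metric.nonempty_ball.2 one_pos)).image φ
    hφ.continuousOn

theorem IsFiniteProper.fibreCount_eq {f : ℂ → ℂ} {U' U V : Set ℂ} (h : IsFiniteProper f U' U)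
    (hV : V ⊆ U') {w : ℂ} (hw : w ∈ U) : fibreCount f V w = count f V w := by
  have hfin : {z | z ∈ V ∧ f z = w}.Finite :=
    (h.finite_fibre w hw).subset fun z hz => ⟨hV hz.1, hz.2⟩
  have hfs := hfin.coe_toFinset
  rw [count_eq_sum hfs, Nat.cast_sum]
  have h1 : fibreCount f V w = ∑' z : (hfin.toFinset : Set ℂ), localDegree f z := by
    rw [hfs]
    rfl
  rw [h1, Finset.tsum_subtype']
  refine Finset.sum_congr rfl fun z hz => (h.coe_mult (hV ?_)).symm
  exact ((hfin.mem_toFinset).1 hz).1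

namespace IsGenPolyLikeMap

variable {N : ℕ} {f : ℂ → ℂ} {U' U : Set ℂ} {V : Fin N → Set ℂ} {d : ℕ}

/-- A finite total degree bounds every fibre count, which excludes infinite local degrees and, as
each point counts at least once, infinite fibres. -/
theorem isFiniteProper (hf : IsGenPolyLikeMap f U' U V)
    (hd : ∑ i, mapDegree f (V i) U = (d : ℕ∞)) : IsFiniteProper f U' U := by
  have hU' : IsOpen U' := by
    rw [hf.domain_eq]
    exact isOpen_iUnion fun i => (hf.disk_piece i).1
  have hcount : ∀ i, ∀ w ∈ U, fibreCount f (V i) w ≠ ⊤ := by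
    intro i w hw htop
    have h1 : fibreCount f (V i) w ≤ mapDegree f (V i) U :=
      le_iSup₂ (f := fun w (_ : w ∈ U) => fibreCount f (V i) w) w hw
    have h2 : mapDegree f (V i) U ≤ (d : ℕ∞) := hd ▸
      Finset.single_le_sum (f := fun i => mapDegree f (V i) U) (fun _ _ => zero_le)
        (Finset.mem_univ i)
    exact ENat.natCast_ne_top d (top_le_iff.1 (htop ▸ h1.trans h2))
  have hV : ∀ i, V i ⊆ U' := fun i => hf.domain_eq ▸ subset_iUnion V i
  refine ⟨hU', hf.disk_codomain.1, hf.holomorphic, hf.mapsTo, hf.proper, ?_, ?_⟩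
  · intro z hz htop
    obtain ⟨i, hi⟩ := mem_iUnion.1 (hf.domain_eq ▸ hz)
    exact hcount i (f z) (hf.mapsTo hz) (top_le_iff.1 (htop ▸ localDegree_le_fibreCount f hi))
  · intro w hw
    have : {z | z ∈ U' ∧ f z = w} = ⋃ i, {z | z ∈ V i ∧ f z = w} := by
      ext z
      simp [hf.domain_eq]
    rw [this]
    refine finite_iUnion fun i => finite_of_fibreCount_ne_top (fun z hz => ?_) (hcount i w hw)
    exact localDegree_ne_zero (hf.holomorphic.analyticAt (hU'.mem_nhds (hV i hz)))

/-- Each `V i` is relatively clopen in `U'`, so its count is constant on the connected set `U` and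
the supremum in `mapDegree` is attained at every point. -/
theorem count_eq_degree (hf : IsGenPolyLikeMap f U' U V)
    (hd : ∑ i, mapDegree f (V i) U = (d : ℕ∞)) {w : ℂ} (hw : w ∈ U) : count f U' w = d := by
  classical
  have h := hf.isFiniteProper hd
  have hV : ∀ i, V i ⊆ U' := fun i => hf.domain_eq ▸ subset_iUnion V i
  have hconst : ∀ i, ∀ w' ∈ U, count f (V i) w' = count f (V i) w := by
    intro i w' hw'
    refine h.count_eq_of_isPreconnected (hV i) hf.disk_codomain.isConnected.isPreconnected
      Subset.rfl ?_ hw' hw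
    intro z hz _
    obtain ⟨j, hj⟩ := mem_iUnion.1 (hf.domain_eq ▸ hz)
    have hjn : V j ∈ 𝓝 z := (hf.disk_piece j).1.mem_nhds hj
    rcases eq_or_ne j i with rfl | hne
    · exact Or.inl hjn
    · exact Or.inr (mem_of_superset hjn (hf.disjoint_pieces j i hne).subset_compl_right)
  have hdeg : ∀ i, mapDegree f (V i) U = count f (V i) w := by
    intro i
    apply le_antisymm
    · refine iSup₂_le fun w' hw' => ?_
      rw [h.fibreCount_eq (hV i) hw', hconst i w' hw']
    · rw [← h.fibreCount_eq (hV i) hw]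
      exact le_iSup₂ (f := fun w (_ : w ∈ U) => fibreCount f (V i) w) w hw
  have hsum : ∑ i, count f (V i) w = d := by
    rw [Finset.sum_congr rfl fun i _ => hdeg i] at hd
    exact_mod_cast hd
  have hfin : ∀ i, {z | z ∈ V i ∧ f z = w}.Finite := fun i =>
    (h.finite_fibre w hw).subset fun z hz => ⟨hV i hz.1, hz.2⟩
  have hunion : ((Finset.univ.biUnion fun i => (hfin i).toFinset : Finset ℂ) : Set ℂ) =
      {z | z ∈ U' ∧ f z = w} := by
    ext z
    simp [hf.domain_eq]
  rw [← hsum, count_eq_sum hunion, Finset.sum_biUnion]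
  · exact Finset.sum_congr rfl fun i _ => (count_eq_sum (hfin i).coe_toFinset).symm
  · intro i _ j _ hne
    refine Finset.disjoint_left.2 fun z hz hz' => ?_
    exact disjoint_left.1 (hf.disjoint_pieces i j hne) ((hfin i).mem_toFinset.1 hz).1
      ((hfin j).mem_toFinset.1 hz').1

end IsGenPolyLikeMap

/-! ### Levels and pieces -/

/-- The set of points whose first `n` images under `f : U' → U` are defined. -/
def level (f : ℂ → ℂ) (U' U : Set ℂ) : ℕ → Set ℂ
  | 0 => U
  | n + 1 => {z | z ∈ U' ∧ f z ∈ level f U' U n}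

/-- The index of the connected component of `x` in `level f U' U n`: the first term of a dense
sequence which it contains. -/
def pieceIndex (f : ℂ → ℂ) (U' U : Set ℂ) (x : ℂ) (n : ℕ) : ℕ :=
  sInf {k | TopologicalSpace.denseSeq ℂ k ∈ connectedComponentIn (level f U' U n) x}

variable {f : ℂ → ℂ} {U' U : Set ℂ}

theorem filledJulia_mapsTo : MapsTo f (filledJulia f U') (filledJulia f U') :=
  fun _ hz => ⟨hz.2 1, fun n => hz.2 (n + 1)⟩

theorem mem_filledJulia_of_map {z : ℂ} (hz : z ∈ U') (hfz : f z ∈ filledJulia f U') :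
    z ∈ filledJulia f U' := by
  refine ⟨hz, fun n => ?_⟩
  cases n with
  | zero => exact hz
  | succ n => exact hfz.2 n

theorem filledJulia_subset_level (hU : U' ⊆ U) (n : ℕ) :
    filledJulia f U' ⊆ level f U' U n := by
  induction n with
  | zero => exact fun z hz => hU hz.1
  | succ n ih => exact fun z hz => ⟨hz.1, ih (filledJulia_mapsTo hz)⟩

theorem iterate_mem_of_mem_level {n : ℕ} : ∀ {z : ℂ}, z ∈ level f U' U (n + 1) → f^[n] z ∈ U' := by
  induction n with
  | zero => exact fun hz => hz.1
  | succ n ih => exact fun hz => ih hz.2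

theorem filledJulia_eq_iInter_level (hU : U' ⊆ U) :
    filledJulia f U' = ⋂ n, level f U' U (n + 1) := by
  apply Subset.antisymm
  · exact subset_iInter fun n => filledJulia_subset_level hU (n + 1)
  · intro z hz
    rw [mem_iInter] at hz
    exact ⟨(hz 0).1, fun n => iterate_mem_of_mem_level (hz n)⟩

theorem level_succ_subset (hU : U' ⊆ U) (n : ℕ) : level f U' U (n + 1) ⊆ level f U' U n := by
  induction n with
  | zero => exact fun z hz => hU hz.1
  | succ n ih => exact fun z hz => ⟨hz.1, ih hz.2⟩

theorem level_antitone (hU : U' ⊆ U) : Antitone (level f U' U) :=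
  antitone_nat_of_succ_le (level_succ_subset hU)

namespace IsFiniteProper

theorem isOpen_level (h : IsFiniteProper f U' U) (n : ℕ) : IsOpen (level f U' U n) := by
  induction n with
  | zero => exact h.isOpen_codomain
  | succ n ih => exact h.holomorphic.continuousOn.isOpen_inter_preimage h.isOpen_domain ih

theorem isCompact_preimage (h : IsFiniteProper f U' U) {C : Set ℂ} (hC : IsCompact C)
    (hCU : C ⊆ U) : IsCompact {z | z ∈ U' ∧ f z ∈ C} := by
  have h1 : IsCompact (Subtype.val ⁻¹' C : Set U) := by
    rw [Subtype.isCompact_iff, Subtype.image_preimage_coe, inter_eq_right.2 hCU]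
    exact hC
  have h2 := (h.proper.isCompact_preimage h1).image continuous_subtype_val
  convert h2 using 1
  ext z
  constructor
  · exact fun hz => ⟨⟨z, hz.1⟩, hz.2, rfl⟩
  · rintro ⟨w, hw, rfl⟩
    exact ⟨w.2, hw⟩

/-- By induction, since preimages of compact sets under a proper map are compact. It makes the
filled-in Julia set an intersection of compact sets. -/
theorem closure_level_subset (h : IsFiniteProper f U' U) (hc : IsCompact (closure U'))
    (hU : closure U' ⊆ U) (n : ℕ) : closure (level f U' U (n + 1)) ⊆ level f U' U n := by
  have hsub : ∀ n, level f U' U (n + 1) ⊆ U' := fun n z hz => hz.1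
  have hcpt : ∀ n, IsCompact (closure (level f U' U (n + 1))) := fun n =>
    hc.of_isClosed_subset isClosed_closure (closure_mono (hsub n))
  induction n with
  | zero => exact (closure_mono (hsub 0)).trans hU
  | succ n ih =>
    have hsubU : closure (level f U' U (n + 1)) ⊆ U :=
      (closure_mono (hsub n)).trans hU
    have h1 := (h.isCompact_preimage (hcpt n) hsubU).isClosed
    have h2 : level f U' U (n + 2) ⊆ {z | z ∈ U' ∧ f z ∈ closure (level f U' U (n + 1))} :=
      fun z hz => ⟨hz.1, subset_closure hz.2⟩
    exact (closure_minimal h2 h1).trans fun z hz => ⟨hz.1, ih hz.2⟩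

/-- Components of open sets are open, so they meet the dense sequence and the infimum is attained;
equal indices give a point common to both components. -/
theorem pieceIndex_eq_iff (h : IsFiniteProper f U' U) {n : ℕ} {x y : ℂ}
    (hx : x ∈ level f U' U n) (hy : y ∈ level f U' U n) :
    pieceIndex f U' U x n = pieceIndex f U' U y n ↔
      y ∈ connectedComponentIn (level f U' U n) x := by
  have hne : ∀ z ∈ level f U' U n,
      {k | TopologicalSpace.denseSeq ℂ k ∈ connectedComponentIn (level f U' U n) z}.Nonempty := by
    intro z hz
    obtain ⟨_, hw, k, rfl⟩ := (TopologicalSpace.denseRange_denseSeq ℂ).inter_open_nonempty _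
      ((h.isOpen_level n).connectedComponentIn (x := z)) ⟨z, mem_connectedComponentIn hz⟩
    exact ⟨k, hw⟩
  constructor
  · intro hxy
    have h1 := Nat.sInf_mem (hne x hx)
    have h2 := Nat.sInf_mem (hne y hy)
    change TopologicalSpace.denseSeq ℂ (pieceIndex f U' U x n) ∈
      connectedComponentIn (level f U' U n) x at h1
    change TopologicalSpace.denseSeq ℂ (pieceIndex f U' U y n) ∈
      connectedComponentIn (level f U' U n) y at h2
    rw [← hxy] at h2
    rw [connectedComponentIn_eq h1,
      ← connectedComponentIn_eq h2]
    exact mem_connectedComponentIn hy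
  · intro hxy
    rw [pieceIndex, pieceIndex, connectedComponentIn_eq hxy]

theorem pieceIndex_mono (h : IsFiniteProper f U' U) (hU : U' ⊆ U) {n : ℕ} {x y : ℂ}
    (hx : x ∈ level f U' U (n + 1)) (hy : y ∈ level f U' U (n + 1))
    (hxy : pieceIndex f U' U x (n + 1) = pieceIndex f U' U y (n + 1)) :
    pieceIndex f U' U x n = pieceIndex f U' U y n := by
  have hsub := level_succ_subset (f := f) hU n
  rw [h.pieceIndex_eq_iff hx hy] at hxy
  rw [h.pieceIndex_eq_iff (hsub hx) (hsub hy)]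
  exact connectedComponentIn_mono x hsub hxy

theorem pieceIndex_map (h : IsFiniteProper f U' U) {n : ℕ} {x y : ℂ}
    (hx : x ∈ level f U' U (n + 1)) (hy : y ∈ level f U' U (n + 1))
    (hxy : pieceIndex f U' U x (n + 1) = pieceIndex f U' U y (n + 1)) :
    pieceIndex f U' U (f x) n = pieceIndex f U' U (f y) n := by
  rw [h.pieceIndex_eq_iff hx hy] at hxy
  rw [h.pieceIndex_eq_iff hx.2 hy.2]
  have hcont : ContinuousOn f (level f U' U (n + 1)) :=
    h.holomorphic.continuousOn.mono fun z hz => hz.1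
  have hmaps : MapsTo f (level f U' U (n + 1)) (level f U' U n) := fun z hz => hz.2
  exact connectedComponentIn_mono _ hmaps.image_subset
    (hcont.image_connectedComponentIn_subset hx (mem_image_of_mem f hxy))

theorem eventually_pieceIndex_eq (h : IsFiniteProper f U' U) {n : ℕ} {x : ℂ}
    (hx : x ∈ level f U' U n) :
    ∀ᶠ y in 𝓝 x, pieceIndex f U' U y n = pieceIndex f U' U x n := by
  filter_upwards [(h.isOpen_level n).connectedComponentIn.mem_nhds (mem_connectedComponentIn hx)]
    with y hy
  exact ((h.pieceIndex_eq_iff hx (connectedComponentIn_subset _ _ hy)).2 hy).symm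

/-- Points that are separated by a clopen subset of the filled-in Julia set lie in different
pieces of some level. -/
theorem exists_pieceIndex_ne (h : IsFiniteProper f U' U) (hc : IsCompact (closure U'))
    (hU : closure U' ⊆ U) (hK : IsCompact (filledJulia f U')) {g : filledJulia f U' → Bool}
    (hg : Continuous g) {x y : filledJulia f U'} (hxy : g x ≠ g y) :
    ∃ n, pieceIndex f U' U x n ≠ pieceIndex f U' U y n := by
  have hU' : U' ⊆ U := subset_closure.trans hU
  have : CompactSpace (filledJulia f U') := isCompact_iff_compactSpace.1 hK
  have hpart : ∀ b, IsCompact (Subtype.val '' (g ⁻¹' {b}) : Set ℂ) := fun b =>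
    ((isClosed_singleton.preimage hg).isCompact).image continuous_subtype_val
  have hdisj : Disjoint (Subtype.val '' (g ⁻¹' {g x}) : Set ℂ)
      (Subtype.val '' (g ⁻¹' {!(g x)})) := by
    rw [disjoint_left]
    rintro _ ⟨a, ha, rfl⟩ ⟨b, hb, hab⟩
    rw [Subtype.val_injective hab] at hb
    rw [mem_preimage, mem_singleton_iff] at ha hb
    rw [ha] at hb
    cases g x <;> simp at hb
  obtain ⟨A, B, hA, hB, hxA, hyB, hAB⟩ := SeparatedNhds.of_isCompact_isCompact
    (hpart (g x)) (hpart (!(g x))) hdisj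
  have hKAB : ⋂ n, closure (level f U' U (n + 1)) ⊆ A ∪ B := by
    intro z hz
    have hzK : z ∈ filledJulia f U' := by
      rw [filledJulia_eq_iInter_level hU', mem_iInter]
      exact fun n => h.closure_level_subset hc hU (n + 1) (mem_iInter.1 hz (n + 1))
    by_cases hb : g ⟨z, hzK⟩ = g x
    · exact Or.inl (hxA ⟨⟨z, hzK⟩, hb, rfl⟩)
    · exact Or.inr (hyB ⟨⟨z, hzK⟩, Bool.eq_not_of_ne hb, rfl⟩)
  have hcpt : ∀ n, IsCompact (closure (level f U' U (n + 1))) := fun n =>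
    hc.of_isClosed_subset isClosed_closure (closure_mono fun z hz => hz.1)
  -- By compactness a whole level already lies in `A ∪ B`; a connected piece of it cannot meet both.
  obtain ⟨n, hn⟩ := exists_subset_nhds_of_isCompact'
    (Antitone.directed_ge fun m n hmn =>
      closure_mono (level_antitone hU' (Nat.succ_le_succ hmn)))
    hcpt (fun _ => isClosed_closure)
    (fun z hz => (hA.union hB).mem_nhds (hKAB hz))
  refine ⟨n + 1, fun heq => ?_⟩
  have hxl := filledJulia_subset_level hU' (n + 1) x.2
  rw [h.pieceIndex_eq_iff hxl (filledJulia_subset_level hU' (n + 1) y.2)] at heq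
  have hxA' : (x : ℂ) ∈ A := hxA ⟨x, rfl, rfl⟩
  have hyB' : (y : ℂ) ∈ B := hyB ⟨y, Bool.eq_not_of_ne hxy.symm, rfl⟩
  have hsub : connectedComponentIn (level f U' U (n + 1)) (x : ℂ) ⊆ A :=
    isPreconnected_connectedComponentIn.subset_left_of_subset_union hA hB hAB
      (((connectedComponentIn_subset _ _).trans subset_closure).trans hn)
      ⟨x, mem_connectedComponentIn hxl, hxA'⟩
  exact disjoint_left.1 hAB (hsub heq) hyB'

/-- The number of preimages in a union of pieces of level `n + 1` is constant on each piece of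
level `n`. -/
theorem count_biUnion_pieces_eq (h : IsFiniteProper f U' U) (hU : U' ⊆ U) {n : ℕ} (A : Set ℂ)
    {y y' : ℂ} (hy : y ∈ level f U' U n) (hy' : y' ∈ level f U' U n)
    (hyy' : pieceIndex f U' U y n = pieceIndex f U' U y' n) :
    count f (⋃ x ∈ A, connectedComponentIn (level f U' U (n + 1)) x) y =
      count f (⋃ x ∈ A, connectedComponentIn (level f U' U (n + 1)) x) y' := by
  refine h.count_eq_of_isPreconnected (D := connectedComponentIn (level f U' U n) y)
    (iUnion₂_subset fun x _ => (connectedComponentIn_subset _ _).trans fun z hz => hz.1)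
    isPreconnected_connectedComponentIn
    ((connectedComponentIn_subset _ _).trans (level_antitone hU (Nat.zero_le n))) ?_
    (mem_connectedComponentIn hy) ((h.pieceIndex_eq_iff hy hy').1 hyy')
  intro z hz hfz
  have hzl : z ∈ level f U' U (n + 1) := ⟨hz, connectedComponentIn_subset _ _ hfz⟩
  have hnhds := (h.isOpen_level (n + 1)).connectedComponentIn.mem_nhds
    (mem_connectedComponentIn hzl)
  by_cases hzA : ∃ x ∈ A, z ∈ connectedComponentIn (level f U' U (n + 1)) x
  · obtain ⟨x, hxA, hzx⟩ := hzA
    left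
    rw [← connectedComponentIn_eq hzx] at hnhds
    exact mem_of_superset hnhds (subset_biUnion_of_mem (u := fun x =>
      connectedComponentIn (level f U' U (n + 1)) x) hxA)
  · right
    refine mem_of_superset hnhds fun w hw hwA => hzA ?_
    obtain ⟨x, hxA, hwx⟩ := mem_iUnion₂.1 hwA
    refine ⟨x, hxA, ?_⟩
    rw [connectedComponentIn_eq hwx, ← connectedComponentIn_eq hw]
    exact mem_connectedComponentIn hzl

end IsFiniteProper

/-! ### Ordered fibres, sections and the coding map -/

/-- List the elements of a finite set with multiplicities in increasing order. -/
theorem exists_sorted_enumeration {X α : Type*} [LinearOrder α] {κ : X → α}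
    (hκ : Function.Injective κ) (S : Finset X) (m : X → ℕ) {d : ℕ} (hd : ∑ z ∈ S, m z = d) :
    ∃ s : Fin d → X, (∀ a, s a ∈ S ∧ ∑ z ∈ S with κ z < κ (s a), m z ≤ a ∧
        (a : ℕ) < ∑ z ∈ S with κ z ≤ κ (s a), m z) ∧
      ∀ z ∈ S, {a | s a = z}.encard = m z := by
  classical
  have hex : ∀ a : Fin d, ∃ z ∈ S, ∑ w ∈ S with κ w < κ z, m w ≤ a ∧
      (a : ℕ) < ∑ w ∈ S with κ w ≤ κ z, m w := by
    intro a
    have hSne : S.Nonempty := by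
      rw [Finset.nonempty_iff_ne_empty]
      rintro rfl
      have := a.2
      simp at hd
      omega
    obtain ⟨M, hM, hMmax⟩ := S.exists_max_image κ hSne
    -- Slot `a` goes to the least element whose cumulative weight exceeds `a`.
    have hT : (S.filter fun z => (a : ℕ) < ∑ w ∈ S with κ w ≤ κ z, m w).Nonempty := by
      refine ⟨M, Finset.mem_filter.2 ⟨hM, ?_⟩⟩
      rw [Finset.filter_true_of_mem hMmax, hd]
      exact a.2
    obtain ⟨z, hz, hzmin⟩ := Finset.exists_min_image _ κ hT
    obtain ⟨hzS, hza⟩ := Finset.mem_filter.1 hz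
    refine ⟨z, hzS, ?_, hza⟩
    rcases (S.filter fun w => κ w < κ z).eq_empty_or_nonempty with he | hne
    · rw [he, Finset.sum_empty]
      exact Nat.zero_le _
    · obtain ⟨p, hp, hpmax⟩ := Finset.exists_max_image _ κ hne
      obtain ⟨hpS, hpz⟩ := Finset.mem_filter.1 hp
      have hnot : ¬ (a : ℕ) < ∑ w ∈ S with κ w ≤ κ p, m w := fun hlt =>
        (hzmin p (Finset.mem_filter.2 ⟨hpS, hlt⟩)).not_gt hpz
      have heq : (S.filter fun w => κ w < κ z) = S.filter fun w => κ w ≤ κ p := by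
        ext w
        simp only [Finset.mem_filter]
        exact ⟨fun hw => ⟨hw.1, hpmax w (Finset.mem_filter.2 hw)⟩,
          fun hw => ⟨hw.1, hw.2.trans_lt hpz⟩⟩
      rw [heq]
      exact not_lt.1 hnot
  choose s hsS hs1 hs2 using hex
  refine ⟨s, fun a => ⟨hsS a, hs1 a, hs2 a⟩, fun z hz => ?_⟩
  have hle : ∑ w ∈ S with κ w ≤ κ z, m w = ∑ w ∈ S with κ w < κ z, m w + m z := by
    have : (S.filter fun w => κ w ≤ κ z) = insert z (S.filter fun w => κ w < κ z) := by
      ext w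
      simp only [Finset.mem_filter, Finset.mem_insert, le_iff_lt_or_eq]
      constructor
      · rintro ⟨hw, h | h⟩
        · exact Or.inr ⟨hw, h⟩
        · exact Or.inl (hκ h)
      · rintro (rfl | h)
        · exact ⟨hz, Or.inr rfl⟩
        · exact ⟨h.1, Or.inl h.2⟩
    rw [this, Finset.sum_insert (by simp), add_comm]
  have hmono : ∀ {z z' : X}, κ z < κ z' →
      ∑ w ∈ S with κ w ≤ κ z, m w ≤ ∑ w ∈ S with κ w < κ z', m w := by
    intro z z' hzz
    refine Finset.sum_le_sum_of_subset fun w hw => ?_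
    rw [Finset.mem_filter] at hw ⊢
    exact ⟨hw.1, hw.2.trans_lt hzz⟩
  have htot : ∑ w ∈ S with κ w ≤ κ z, m w ≤ d :=
    hd ▸ Finset.sum_le_sum_of_subset (Finset.filter_subset _ _)
  set L := ∑ w ∈ S with κ w < κ z, m w with hL
  -- The slots of `z` form an interval of length `m z`, starting at the total weight `L` below `z`.
  have himg : Fin.val '' {a | s a = z} = ((Finset.Ico L (L + m z) : Finset ℕ) : Set ℕ) := by
    ext k
    simp only [mem_image, mem_ofPred_eq, Finset.coe_Ico, mem_Ico]
    constructor
    · rintro ⟨a, rfl, rfl⟩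
      exact ⟨hs1 a, hle ▸ hs2 a⟩
    · rintro ⟨hk1, hk2⟩
      have hkd : k < d := by omega
      refine ⟨⟨k, hkd⟩, ?_, rfl⟩
      have h1 := hs1 ⟨k, hkd⟩
      have h2 := hs2 ⟨k, hkd⟩
      rcases lt_trichotomy (κ (s ⟨k, hkd⟩)) (κ z) with h | h | h
      · have := hmono h
        simp only at h1 h2
        omega
      · exact hκ h
      · have := hmono h
        simp only at h1 h2
        omega
  rw [← Fin.val_injective.encard_image, himg, encard_coe_eq_coe_finsetCard, Nat.card_Ico]
  simp

/-- The composition of `n` sections along the first `n` letters of `ε`, applied to `y`. -/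
def branch {X : Type*} {d : ℕ} (s : X → Fin d → X) (y : X) : ℕ → (ℕ → Fin d) → X
  | 0, _ => y
  | n + 1, ε => s (branch s y n (shift ε)) (ε 0)

theorem branch_congr {X : Type*} {d : ℕ} (s : X → Fin d → X) (y : X) {n : ℕ} :
    ∀ {ε ε' : ℕ → Fin d}, (∀ i < n, ε i = ε' i) → branch s y n ε = branch s y n ε' := by
  induction n with
  | zero => exact fun _ => rfl
  | succ n ih =>
    intro ε ε' hεε'
    have htail : branch s y n (shift ε) = branch s y n (shift ε') :=
      ih fun i hi => hεε' (i + 1) (by omega)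
    rw [branch, branch, htail, hεε' 0 (by omega)]

/-- A self-map with finite fibres, weighted by `m`, of a space coded by a nested sequence of
partitions; the partition of level `n` is given by the values of `c · n`. -/
structure IsCodedCover {X : Type*} [TopologicalSpace X] (F : X → X) (m : X → ℕ)
    (fib : X → Finset X) (c : X → ℕ → ℕ) (d : ℕ) : Prop where
  mem_fib : ∀ {y z}, z ∈ fib y ↔ F z = y
  sum_fib : ∀ y, ∑ z ∈ fib y, m z = d
  continuous_code : Continuous c
  injective_code : Function.Injective c
  code_zero : ∀ x y, c x 0 = c y 0
  code_mono : ∀ {n x y}, c x (n + 1) = c y (n + 1) → c x n = c y n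
  code_map : ∀ {n x y}, c x (n + 1) = c y (n + 1) → c (F x) n = c (F y) n
  sum_saturated : ∀ {n y y'}, c y n = c y' n → ∀ (A : Set X) [DecidablePred (· ∈ A)],
    (∀ x x', c x (n + 1) = c x' (n + 1) → x ∈ A → x' ∈ A) →
    ∑ z ∈ fib y with z ∈ A, m z = ∑ z ∈ fib y' with z ∈ A, m z

namespace IsCodedCover

variable {X : Type*} [TopologicalSpace X] {F : X → X} {m : X → ℕ} {fib : X → Finset X}
  {c : X → ℕ → ℕ} {d : ℕ}

theorem code_eq_of_le (h : IsCodedCover F m fib c d) {x y : X} {i n : ℕ} (hin : i ≤ n)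
    (hn : c x n = c y n) : c x i = c y i := by
  induction n, hin using Nat.le_induction with
  | base => exact hn
  | succ n _ ih => exact ih (h.code_mono hn)

/-- The first difference of the codes occurs at an index at most `n`, so it does not change when the
points move inside their blocks of level `n`. -/
theorem lex_lt_of_code_eq (h : IsCodedCover F m fib c d) {x x' y y' : X} {n : ℕ}
    (hlt : toLex (c x) < toLex (c y)) (hx : c x n = c x' n) (hy : c y n = c y' n)
    (hne : c x n ≠ c y n) : toLex (c x') < toLex (c y') := by
  obtain ⟨j, hj, hjlt⟩ := hlt
  have hjn : j ≤ n := by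
    by_contra hnj
    exact hne (hj n (not_le.1 hnj))
  refine ⟨j, fun i hi => ?_, ?_⟩
  · have hin : i ≤ n := hi.le.trans hjn
    have := hj i hi
    simp only [Pi.toLex_apply] at this ⊢
    rw [← h.code_eq_of_le hin hx, ← h.code_eq_of_le hin hy, this]
  · simp only [Pi.toLex_apply] at hjlt ⊢
    rwa [← h.code_eq_of_le hjn hx, ← h.code_eq_of_le hjn hy]

/-- The fibres are parametrised by `d` sections which respect the partitions. -/
theorem exists_sections (h : IsCodedCover F m fib c d) :
    ∃ s : X → Fin d → X, (∀ y a, F (s y a) = y) ∧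
      (∀ n y y' a, c y n = c y' n → c (s y a) (n + 1) = c (s y' a) (n + 1)) ∧
      ∀ z, {a | s (F z) a = z}.encard = m z := by
  classical
  have hκ : Function.Injective fun x => toLex (c x) := fun x y hxy => h.injective_code hxy
  choose s hs hcard using fun y => exists_sorted_enumeration hκ (fib y) m (h.sum_fib y)
  refine ⟨s, fun y a => h.mem_fib.1 (hs y a).1, ?_, fun z => hcard (F z) z (h.mem_fib.2 rfl)⟩
  have key : ∀ n y y' a, c y n = c y' n →
      toLex (c (s y a)) < toLex (c (s y' a)) → c (s y a) (n + 1) = c (s y' a) (n + 1) := by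
    intro n y y' a hyy' hlt
    by_contra hne
    -- The initial segment ending with the whole block of `s y a`. Over `y` it has weight more than
    -- `a`; over `y'` it lies strictly below `s y' a`, so its weight is at most `a`. Saturation
    -- makes the two weights equal.
    let A : Set X := {w | toLex (c w) < toLex (c (s y a)) ∨ c w (n + 1) = c (s y a) (n + 1)}
    have hA : ∀ x x', c x (n + 1) = c x' (n + 1) → x ∈ A → x' ∈ A := by
      rintro x x' hxx' (hx | hx)
      · by_cases he : c x (n + 1) = c (s y a) (n + 1)
        · exact Or.inr (hxx' ▸ he)
        · exact Or.inl (h.lex_lt_of_code_eq hx hxx' rfl he)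
      · exact Or.inr (hxx' ▸ hx)
    have h1 : (a : ℕ) < ∑ z ∈ fib y with z ∈ A, m z := by
      refine (hs y a).2.2.trans_le (Finset.sum_le_sum_of_subset fun w hw => ?_)
      rw [Finset.mem_filter] at hw ⊢
      refine ⟨hw.1, ?_⟩
      rcases lt_or_eq_of_le hw.2 with hlt' | heq
      · exact Or.inl hlt'
      · exact Or.inr (congrFun (toLex.injective heq) (n + 1))
    have h2 : ∑ z ∈ fib y' with z ∈ A, m z ≤ a := by
      refine (Finset.sum_le_sum_of_subset fun w hw => ?_).trans (hs y' a).2.1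
      rw [Finset.mem_filter] at hw ⊢
      refine ⟨hw.1, ?_⟩
      rcases hw.2 with hw' | hw'
      · exact hw'.trans hlt
      · exact h.lex_lt_of_code_eq hlt hw'.symm rfl hne
    rw [h.sum_saturated hyy' A hA] at h1
    omega
  intro n y y' a hyy'
  rcases lt_trichotomy (toLex (c (s y a))) (toLex (c (s y' a))) with hlt | heq | hgt
  · exact key n y y' a hyy' hlt
  · exact congrFun (toLex.injective heq) (n + 1)
  · exact (key n y' y a hyy'.symm hgt).symm

/-- The semiconjugacy from the shift determined by sections of a coded cover. -/
theorem exists_semiconj [CompactSpace X] [Nonempty X] (h : IsCodedCover F m fib c d)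
    {s : X → Fin d → X} (hF : ∀ y a, F (s y a) = y)
    (hs : ∀ n y y' a, c y n = c y' n → c (s y a) (n + 1) = c (s y' a) (n + 1)) :
    ∃ π : (ℕ → Fin d) → X, Continuous π ∧ (∀ ε, π (shift ε) = F (π ε)) ∧
      ∀ ε z, π ε = z ↔ ∀ k, s (F^[k + 1] z) (ε k) = F^[k] z := by
  obtain ⟨y₀⟩ := ‹Nonempty X›
  -- All points agree at level 0 and each section gains a level, so the first `n` letters fix the
  -- block of level `n`.
  have hstep : ∀ n ε, c (branch s y₀ (n + 1) ε) n = c (branch s y₀ n ε) n := by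
    intro n
    induction n with
    | zero => exact fun _ => h.code_zero _ _
    | succ n ih => exact fun ε => hs n _ _ _ (ih (shift ε))
  have hclosed : ∀ n ε, IsClosed {x | c x n = c (branch s y₀ n ε) n} := fun n ε =>
    isClosed_eq ((continuous_apply n).comp h.continuous_code) continuous_const
  have hlim : ∀ ε, ∃ x, ∀ n, c x n = c (branch s y₀ n ε) n := by
    intro ε
    obtain ⟨x, hx⟩ := IsCompact.nonempty_iInter_of_sequence_nonempty_isCompact_isClosed
      (fun n => {x | c x n = c (branch s y₀ n ε) n})
      (fun n x hx => (h.code_mono hx).trans (hstep n ε)) (fun n => ⟨_, rfl⟩)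
      (hclosed 0 ε).isCompact (fun n => hclosed n ε)
    exact ⟨x, fun n => mem_iInter.1 hx n⟩
  choose π hπ using hlim
  have huniq : ∀ ε x, (∀ n, c x n = c (branch s y₀ n ε) n) → π ε = x := fun ε x hx =>
    h.injective_code (funext fun n => (hπ ε n).trans (hx n).symm)
  have hsucc : ∀ ε, s (π (shift ε)) (ε 0) = π ε := by
    refine fun ε => (huniq ε _ fun n => ?_).symm
    cases n with
    | zero => exact h.code_zero _ _
    | succ n => exact hs n _ _ _ (hπ (shift ε) n)
  have hconj : ∀ ε, π (shift ε) = F (π ε) := fun ε => by rw [← hsucc ε, hF]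
  have hconjk : ∀ k ε, π (shift^[k] ε) = F^[k] (π ε) := by
    intro k
    induction k with
    | zero => exact fun _ => rfl
    | succ k ih =>
      intro ε
      rw [Function.iterate_succ_apply, Function.iterate_succ_apply, ih, hconj]
  have hshift : ∀ k (ε : ℕ → Fin d) i, shift^[k] ε i = ε (i + k) := by
    intro k
    induction k with
    | zero => exact fun _ _ => rfl
    | succ k ih =>
      intro ε i
      rw [Function.iterate_succ_apply, ih, shift, add_assoc]
  refine ⟨π, ?_, hconj, fun ε z => ⟨?_, ?_⟩⟩
  -- Since `X` is compact, `c` is an embedding, and continuity can be tested on each code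
  -- coordinate.
  · have hemb : IsClosedEmbedding c := h.continuous_code.isClosedEmbedding h.injective_code
    rw [hemb.continuous_iff]
    refine continuous_pi fun n => (IsLocallyConstant.iff_eventually_eq _).2 (fun ε => ?_) |>.continuous
    have hnhds : ∀ᶠ ε' in 𝓝 ε, ∀ i ∈ Finset.range n, ε' i = ε i := by
      rw [Finset.eventually_all]
      intro i _
      exact ((continuous_apply i).tendsto ε).eventually (isOpen_discrete {ε i} |>.mem_nhds rfl)
    filter_upwards [hnhds] with ε' hε'
    change c (π ε') n = c (π ε) n
    rw [hπ, hπ, branch_congr s y₀ fun i hi => hε' i (Finset.mem_range.2 hi)]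
  · rintro rfl k
    have := hsucc (shift^[k] ε)
    rwa [← Function.iterate_succ_apply' shift, hconjk, hconjk, hshift, zero_add] at this
  · intro hz
    refine huniq ε z fun n => ?_
    clear huniq hsucc
    induction n generalizing ε z with
    | zero => exact h.code_zero _ _
    | succ n ih =>
      have h0 : s (F z) (ε 0) = z := hz 0
      have h1 := ih (shift ε) (F z) fun k => hz (k + 1)
      have h2 := hs n _ _ (ε 0) h1
      rwa [h0] at h2

end IsCodedCover

/-! ### Total branching as a finite product -/

/-- From `k₀` on the letters are forced, so restriction to the first `k₀` coordinates is a bijection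
onto a finite product. -/
theorem encard_setOf_forall_mem {d k₀ : ℕ} (A : ℕ → Set (Fin d))
    (hA : ∀ k, k₀ ≤ k → (A k).encard = 1) :
    {ε : ℕ → Fin d | ∀ k, ε k ∈ A k}.encard = ∏ k ∈ Finset.range k₀, (A k).encard := by
  have hinj : InjOn (fun (ε : ℕ → Fin d) (k : Fin k₀) => ε k) {ε | ∀ k, ε k ∈ A k} := by
    intro ε hε ε' hε' heq
    funext k
    rcases lt_or_ge k k₀ with hk | hk
    · exact congrFun heq ⟨k, hk⟩
    · exact encard_le_one_iff.1 (hA k hk).le _ _ (hε k) (hε' k)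
  have himg : (fun (ε : ℕ → Fin d) (k : Fin k₀) => ε k) '' {ε | ∀ k, ε k ∈ A k} =
      Set.univ.pi fun k : Fin k₀ => A k := by
    ext δ
    constructor
    · rintro ⟨ε, hε, rfl⟩ k _
      exact hε k
    · intro hδ
      have hne : ∀ k, k₀ ≤ k → (A k).Nonempty := fun k hk =>
        encard_ne_zero.1 (by rw [hA k hk]; exact one_ne_zero)
      have : Nonempty (Fin d) := ⟨(hne k₀ le_rfl).some⟩
      choose! p hp using hne
      refine ⟨fun k => if hk : k < k₀ then δ ⟨k, hk⟩ else p k, fun k => ?_, ?_⟩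
      · by_cases hk : k < k₀
        · simpa [hk] using hδ ⟨k, hk⟩ (mem_univ _)
        · simpa [hk] using hp k (not_lt.1 hk)
      · funext k
        simp
  rw [← hinj.encard_image, himg, encard_pi_eq_prod_encard, Finset.prod_range]

theorem localDegree_comp {g : ℂ → ℂ} {z : ℂ} (hf : AnalyticAt ℂ f (g z)) (hg : AnalyticAt ℂ g z) :
    localDegree (f ∘ g) z = localDegree f (g z) * localDegree g z :=
  AnalyticAt.analyticOrderAt_comp (f := fun w => f w - f (g z)) (hf.sub analyticAt_const) hg

theorem iterate_mem_filledJulia {z : ℂ} (hz : z ∈ filledJulia f U') (n : ℕ) :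
    f^[n] z ∈ filledJulia f U' :=
  filledJulia_mapsTo.iterate n hz

namespace IsFiniteProper

theorem analyticAt_iterate (h : IsFiniteProper f U' U) {z : ℂ} (hz : z ∈ filledJulia f U')
    (n : ℕ) : AnalyticAt ℂ f^[n] z := by
  induction n with
  | zero => exact analyticAt_id
  | succ n ih =>
    rw [Function.iterate_succ']
    exact (h.analyticAt (hz.2 n)).comp ih

theorem localDegree_iterate (h : IsFiniteProper f U' U) {z : ℂ} (hz : z ∈ filledJulia f U')
    (n : ℕ) : localDegree f^[n] z = ((∏ k ∈ Finset.range n, mult f (f^[k] z) : ℕ) : ℕ∞) := by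
  induction n with
  | zero => simpa using localDegree_eq_one (f := id) analyticAt_id (by simp)
  | succ n ih =>
    rw [Function.iterate_succ', localDegree_comp (h.analyticAt (hz.2 n)) (h.analyticAt_iterate hz n),
      ih, Finset.prod_range_succ, Nat.cast_mul, h.coe_mult (hz.2 n), mul_comm]

/-- The local degrees of the iterates are partial products of factors at least one, constant from
`k₀` on. -/
theorem chi_eq_prod (h : IsFiniteProper f U' U) {z : ℂ} (hz : z ∈ filledJulia f U') {k₀ : ℕ}
    (hk₀ : ∀ k, k₀ ≤ k → mult f (f^[k] z) = 1) :
    chi f z = ((∏ k ∈ Finset.range k₀, mult f (f^[k] z) : ℕ) : ℕ∞) := by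
  apply le_antisymm
  · refine iSup_le fun n => ?_
    rw [h.localDegree_iterate hz, Nat.cast_le]
    have h1 : ∏ k ∈ Finset.range k₀, mult f (f^[k] z) =
        ∏ k ∈ Finset.range (max n k₀), mult f (f^[k] z) := by
      refine Finset.prod_subset (Finset.range_mono (le_max_right _ _)) fun k _ hk => hk₀ k ?_
      simpa using hk
    rw [h1]
    exact Finset.prod_le_prod_of_subset_of_one_le' (Finset.range_mono (le_max_left _ _))
      fun k _ _ => h.mult_pos (hz.2 k)
  · rw [← h.localDegree_iterate hz]
    exact le_iSup (fun n => localDegree f^[n] z) k₀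

/-- At an accumulation point of zeros the derivative would vanish identically nearby, making the
local degree infinite. -/
theorem finite_deriv_eq_zero (h : IsFiniteProper f U' U) (hK : IsCompact (filledJulia f U')) :
    {z | z ∈ filledJulia f U' ∧ deriv f z = 0}.Finite := by
  by_contra hinf
  obtain ⟨z, hz, hacc⟩ := Set.Infinite.exists_accPt_of_subset_isCompact hinf hK fun z hz => hz.1
  have hfz := h.analyticAt hz.1
  rw [accPt_iff_frequently_nhdsNE] at hacc
  rcases hfz.deriv.eventually_eq_zero_or_eventually_ne_zero with h0 | h0
  · apply h.localDegree_ne_top z hz.1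
    rw [localDegree, ← hfz.analyticOrderAt_deriv_add_one, analyticOrderAt_eq_top.2 h0, top_add]
  · obtain ⟨w, hw, hw'⟩ := (hacc.and_eventually h0).exists
    exact hw' hw.2

/-- A superattracting periodic point is interior to the filled-in Julia set. -/
theorem mem_interior_of_deriv_eq_zero (h : IsFiniteProper f U' U) {c : ℂ}
    (hc : c ∈ filledJulia f U') (hderiv : deriv f c = 0) {q : ℕ} (hq : f^[q + 1] c = c) :
    c ∈ interior (filledJulia f U') := by
  have hd : HasDerivAt f^[q + 1] 0 c := by
    have h1 : HasDerivAt f 0 c := hderiv ▸ (h.analyticAt hc.1).differentiableAt.hasDerivAt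
    have h2 := ((h.analyticAt_iterate (filledJulia_mapsTo hc) q).differentiableAt.hasDerivAt).comp
      c h1
    rwa [mul_zero, ← Function.iterate_succ] at h2
  -- The constant 1 suffices: small balls around `c` only have to be mapped into themselves.
  have hcontr : ∀ᶠ w in 𝓝 c, ‖f^[q + 1] w - c‖ ≤ 1 * ‖w - c‖ := by
    have := (hasDerivAt_iff_isLittleO.1 hd).bound one_pos
    simpa only [hq, smul_zero, sub_zero] using this
  have hstay : ∀ᶠ w in 𝓝 c, ∀ j ∈ Finset.range (q + 1), f^[j] w ∈ U' :=
    (Finset.eventually_all _).2 fun j _ =>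
      (h.analyticAt_iterate hc j).continuousAt (h.isOpen_domain.mem_nhds (hc.2 j))
  obtain ⟨r, hr, hball⟩ := Metric.eventually_nhds_iff_ball.1 (hcontr.and hstay)
  have hmaps : MapsTo f^[q + 1] (Metric.ball c r) (Metric.ball c r) := by
    intro w hw
    have := (hball w hw).1
    rw [mem_ball_iff_norm] at hw ⊢
    linarith
  refine mem_interior.2 ⟨Metric.ball c r, fun w hw => ?_, Metric.isOpen_ball,
    Metric.mem_ball_self hr⟩
  have hall : ∀ n, f^[n] w ∈ U' := by
    intro n
    have h1 := hmaps.iterate (n / (q + 1)) hw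
    rw [← Function.iterate_mul] at h1
    have h2 := (hball _ h1).2 (n % (q + 1)) (Finset.mem_range.2 (Nat.mod_lt _ (Nat.succ_pos q)))
    rwa [← Function.iterate_add_apply, Nat.mod_add_div] at h2
  exact ⟨hall 0, hall⟩

/-- An orbit meeting the finite critical set infinitely often repeats a critical point, which is
then periodic and superattracting, hence interior. -/
theorem exists_forall_mult_iterate_eq_one (h : IsFiniteProper f U' U)
    (hK : IsCompact (filledJulia f U')) (hint : interior (filledJulia f U') = ∅) {z : ℂ}
    (hz : z ∈ filledJulia f U') : ∃ k₀, ∀ k, k₀ ≤ k → mult f (f^[k] z) = 1 := by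
  have hfin : {k | deriv f (f^[k] z) = 0}.Finite := by
    by_contra hinf
    have hmaps : MapsTo (fun k => f^[k] z) {k | deriv f (f^[k] z) = 0}
        {z | z ∈ filledJulia f U' ∧ deriv f z = 0} :=
      fun k hk => ⟨iterate_mem_filledJulia hz k, hk⟩
    obtain ⟨i, hi, j, hj, hij, heq⟩ :=
      Set.Infinite.exists_ne_map_eq_of_mapsTo hinf hmaps (h.finite_deriv_eq_zero hK)
    wlog hlt : i < j generalizing i j
    · exact this j hj i hi hij.symm heq.symm (lt_of_le_of_ne (not_lt.1 hlt) hij.symm)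
    obtain ⟨q, rfl⟩ := Nat.exists_eq_add_of_lt hlt
    have hper : f^[q + 1] (f^[i] z) = f^[i] z := by
      rw [← Function.iterate_add_apply]
      refine Eq.trans ?_ heq.symm
      rw [show q + 1 + i = i + q + 1 by omega]
    have := h.mem_interior_of_deriv_eq_zero (iterate_mem_filledJulia hz i) hi hper
    rw [hint] at this
    exact this
  obtain ⟨M, hM⟩ := hfin.bddAbove
  refine ⟨M + 1, fun k hk => mult_eq_one (h.analyticAt (hz.2 k)) fun h0 => ?_⟩
  have := hM (show k ∈ {k | deriv f (f^[k] z) = 0} from h0)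
  omega

end IsFiniteProper

/-! ### From pieces to a coded cover, and the theorem -/

/-- The pieces of all levels turn a filled-in Julia set homeomorphic to the Cantor space into a
coded cover. -/
theorem IsFiniteProper.exists_isCodedCover (h : IsFiniteProper f U' U) {d : ℕ}
    (hd : ∀ w ∈ U, count f U' w = d) (hUc : IsPreconnected U)
    (hc : IsCompact (closure U')) (hU : closure U' ⊆ U)
    (e : filledJulia f U' ≃ₜ (ℕ → Bool)) :
    ∃ fib : filledJulia f U' → Finset (filledJulia f U'),
      IsCodedCover (filledJulia_mapsTo.restrict f (filledJulia f U') (filledJulia f U'))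
        (fun z => mult f z) fib (fun z => pieceIndex f U' U z) d := by
  classical
  have hU' : U' ⊆ U := subset_closure.trans hU
  have hK : IsCompact (filledJulia f U') := by
    have := e.symm.compactSpace
    exact isCompact_iff_compactSpace.2 this
  have hlev : ∀ n (x : filledJulia f U'), (x : ℂ) ∈ level f U' U n := fun n x =>
    filledJulia_subset_level hU' n x.2
  have hfin : ∀ y : filledJulia f U', {z : filledJulia f U' | f z = y}.Finite := fun y =>
    ((h.finite_fibre y (hlev 0 y)).preimage Subtype.val_injective.injOn).subset
      fun z hz => ⟨z.2.1, hz⟩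
  have hmem : ∀ y z, z ∈ (hfin y).toFinset ↔ f z = y := fun y z => (hfin y).mem_toFinset
  -- Preimages in `U'` of points of the filled-in Julia set lie in it again, so counts in the plane
  -- are sums over it.
  have hsum : ∀ (B : Set ℂ) (y : filledJulia f U') (S : Finset (filledJulia f U')), B ⊆ U' →
      (∀ z, z ∈ S ↔ f z = y ∧ (z : ℂ) ∈ B) → count f B y = ∑ z ∈ S, mult f z := by
    intro B y S hB hS
    have hcoe : ((S.map (Function.Embedding.subtype _) : Finset ℂ) : Set ℂ) =
        {z | z ∈ B ∧ f z = y} := by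
      ext z
      simp only [Finset.coe_map, Function.Embedding.subtype_apply, mem_image, Finset.mem_coe, hS,
        mem_ofPred_eq]
      constructor
      · rintro ⟨x, hx, rfl⟩
        exact ⟨hx.2, hx.1⟩
      · rintro ⟨hz, hzy⟩
        exact ⟨⟨z, mem_filledJulia_of_map (hB hz) (hzy ▸ y.2)⟩, ⟨hzy, hz⟩, rfl⟩
    rw [count_eq_sum hcoe, Finset.sum_map]
    rfl
  refine ⟨fun y => (hfin y).toFinset, ?_, ?_, ?_, ?_, ?_, ?_, ?_, ?_⟩
  · intro y z
    rw [hmem, Subtype.ext_iff]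
    rfl
  · intro y
    rw [← hsum U' y _ Subset.rfl fun z => ?_]
    · exact hd y (hlev 0 y)
    · rw [hmem, and_iff_left z.2.1]
  · refine continuous_pi fun n => IsLocallyConstant.continuous ?_
    refine (IsLocallyConstant.iff_eventually_eq _).2 fun x => ?_
    exact continuous_subtype_val.continuousAt.eventually (h.eventually_pieceIndex_eq (hlev n x))
  · intro x y hxy
    by_contra hne
    have hexy : e x ≠ e y := e.injective.ne hne
    -- A coordinate of the Cantor space where the points differ provides the separating clopen set.
    obtain ⟨i, hi⟩ := Function.ne_iff.1 hexy
    obtain ⟨n, hn⟩ := h.exists_pieceIndex_ne hc hU hK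
      ((continuous_apply i).comp e.continuous) hi
    exact hn (congrFun hxy n)
  · intro x y
    rw [h.pieceIndex_eq_iff (hlev 0 x) (hlev 0 y)]
    exact hUc.subset_connectedComponentIn (hlev 0 x) Subset.rfl (hlev 0 y)
  · exact fun {n x y} => h.pieceIndex_mono hU' (hlev (n + 1) x) (hlev (n + 1) y)
  · exact fun {n x y} => h.pieceIndex_map (hlev (n + 1) x) (hlev (n + 1) y)
  · intro n y y' hyy' A _ hA
    have hB : ⋃ x ∈ Subtype.val '' A, connectedComponentIn (level f U' U (n + 1)) x ⊆ U' :=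
      iUnion₂_subset fun x _ => (connectedComponentIn_subset _ _).trans fun z hz => hz.1
    have hzB : ∀ z : filledJulia f U',
        (z : ℂ) ∈ ⋃ x ∈ Subtype.val '' A, connectedComponentIn (level f U' U (n + 1)) x ↔
          z ∈ A := by
      intro z
      rw [mem_iUnion₂]
      constructor
      · rintro ⟨_, ⟨x, hx, rfl⟩, hzx⟩
        exact hA x z ((h.pieceIndex_eq_iff (hlev _ x) (hlev _ z)).2 hzx) hx
      · exact fun hz => ⟨z, mem_image_of_mem _ hz, mem_connectedComponentIn (hlev _ z)⟩
    have hfilter : ∀ y z, z ∈ (hfin y).toFinset.filter (· ∈ A) ↔ f z = y ∧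
        (z : ℂ) ∈ ⋃ x ∈ Subtype.val '' A, connectedComponentIn (level f U' U (n + 1)) x := by
      intro y z
      rw [Finset.mem_filter, hmem, hzB]
    rw [← hsum _ y _ hB (hfilter y), ← hsum _ y' _ hB (hfilter y')]
    exact h.count_biUnion_pieces_eq hU' _ (hlev n y) (hlev n y') hyy'

end GenPolyLike

end

theorem mainTheorem1 {N : ℕ} (f : ℂ → ℂ) (U' U : Set ℂ) (V : Fin N → Set ℂ)
    (hf : GenPolyLike.IsGenPolyLikeMap f U' U V)
    (d : ℕ) (hd : ∑ i, GenPolyLike.mapDegree f (V i) U = (d : ℕ∞)) (hd1 : 1 < d)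
    (hKJ : GenPolyLike.filledJulia f U' = GenPolyLike.julia f U')
    (hCantor : GenPolyLike.IsCantorSet (GenPolyLike.julia f U'))
    (hcrit : ∀ c ∈ U', deriv f c = 0 → c ∈ GenPolyLike.julia f U') :
    ∃ π : (ℕ → Fin d) → GenPolyLike.julia f U',
      Continuous π ∧ Function.Surjective π ∧
      (∀ ε, (π (GenPolyLike.shift ε) : ℂ) = f (π ε)) ∧
      ∀ z : GenPolyLike.julia f U',
        GenPolyLike.chi f z < ⊤ ∧ (π ⁻¹' {z}).encard = GenPolyLike.chi f z := by
  have hint : interior (GenPolyLike.filledJulia f U') = ∅ := by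
    rw [eq_empty_iff_forall_notMem]
    intro z hz
    have hz' := interior_subset hz
    rw [hKJ] at hz'
    exact hz'.2 hz
  rw [← hKJ] at hCantor ⊢
  obtain ⟨e⟩ := hCantor
  have h := hf.isFiniteProper hd
  obtain ⟨fib, hcov⟩ := h.exists_isCodedCover (fun w hw => hf.count_eq_degree hd hw)
    hf.disk_codomain.isConnected.isPreconnected hf.compact_closure hf.closure_subset e
  have hcpt := e.symm.compactSpace
  have hne : Nonempty (GenPolyLike.filledJulia f U') := ⟨e.symm fun _ => true⟩
  obtain ⟨s, hsF, hs, hcard⟩ := hcov.exists_sections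
  obtain ⟨π, hcont, hconj, hfib⟩ := hcov.exists_semiconj hsF hs
  set F := GenPolyLike.filledJulia_mapsTo.restrict f (GenPolyLike.filledJulia f U')
    (GenPolyLike.filledJulia f U') with hF
  have hiter : ∀ (k : ℕ) (z : GenPolyLike.filledJulia f U'), (F^[k] z : ℂ) = f^[k] z := by
    intro k
    induction k with
    | zero => exact fun _ => rfl
    | succ k ih => exact fun z => ih (F z)
  have hencard : ∀ z : GenPolyLike.filledJulia f U',
      (π ⁻¹' {z}).encard = GenPolyLike.chi f z ∧ GenPolyLike.chi f z < ⊤ ∧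
        GenPolyLike.chi f z ≠ 0 := by
    intro z
    obtain ⟨k₀, hk₀⟩ := h.exists_forall_mult_iterate_eq_one (isCompact_iff_compactSpace.2 hcpt)
      hint z.2
    have hA : ∀ k, {a | s (F^[k + 1] z) a = F^[k] z}.encard =
        (GenPolyLike.mult f (f^[k] z) : ℕ∞) := by
      intro k
      rw [Function.iterate_succ_apply', hcard, hiter]
    -- Each letter is constrained separately, so the fibre is a product of sets of letters.
    have hpre : π ⁻¹' {z} = {ε | ∀ k, ε k ∈ {a | s (F^[k + 1] z) a = F^[k] z}} := by
      ext ε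
      exact hfib ε z
    rw [hpre, GenPolyLike.encard_setOf_forall_mem (k₀ := k₀) _
      (fun k hk => by rw [hA, hk₀ k hk, Nat.cast_one]), h.chi_eq_prod z.2 hk₀,
      Finset.prod_congr rfl fun k _ => hA k, Nat.cast_prod]
    refine ⟨rfl, ?_, ?_⟩
    · rw [← Nat.cast_prod]
      exact ENat.natCast_lt_top _
    · rw [← Nat.cast_prod, Nat.cast_ne_zero, Finset.prod_ne_zero_iff]
      exact fun k _ => (h.mult_pos (z.2.2 k)).ne'
  refine ⟨π, hcont, fun z => ?_, fun ε => congrArg Subtype.val (hconj ε),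
    fun z => ⟨(hencard z).2.1, (hencard z).1⟩⟩
  -- Surjectivity is the nonvanishing of the fibre cardinality.
  have hz := (hencard z).2.2
  rw [← (hencard z).1, encard_ne_zero] at hz
  exact hz
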